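/- Let $T$ be the theory of the free pseudoplane: the language has a single binary relation $I$, and the axioms say that $I$ is symmetric and irreflexive, that for each $a$ there are infinitely many $b$ with $I(a,b)$, and that there are no loops, i.e. for no $n\ge 3$ are there $a_0,\dots,a_n$ with $I(a_i,a_{i+1})$ for all $i<n$, with $a_0,\dots,a_{n-1}$ distinct and $a_0=a_n$. Let $\bar M$ be a saturated model of $T$. Let $\bar M^{eq}$ be its expansion by imaginaries, i.e. by sorts $\bar M^n/E$ for every $n$ and every $\emptyset$-definable equivalence relation $E$ on $\bar M^n$, together with the quotient maps. Algebraic closure $\mathrm{acl}$ is taken in $\bar M^{eq}$: $\mathrm{acl}(c)$ is the set of elements lying in a finite $c$-definable set. For a definable set $X$ and a small set $A\subseteq \bar M^{eq}$ of parameters, $X$ is called weakly normal relative to $A$ if $X\neq\emptyset$ and every $x\in X$ belongs to only finitely many of the sets $\sigma(X)$, where $\sigma$ ranges over the automorphisms of $\bar M^{eq}$ fixing $A$ pointwise; $X$ is weakly normal if it is weakly normal relative to $\emptyset$. A formula is called weakly normal (relative to $A$) if the set it defines is. Let $a\in\bar M$. Then: (i) The formula $I(x,a)$ is not weakly normal.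 (ii) There is no $c\in\bar M^{eq}$ such that $a\notin\mathrm{acl}(c)$ and $I(x,a)$ is weakly normal relative to $c$. -/

import Mathlib

open FirstOrder

namespace FreePseudoplane

universe u v w

section General

variable (L : FirstOrder.Language.{u, v})

/-- `M` is saturated: for every set `A` of fewer than `|M|` parameters, every set of formulas over
`A` in one variable that is finitely satisfiable in `M` (a partial 1-type over `A`) is realized
in `M`. -/
def IsSaturated (M : Type w) [L.Structure M] : Prop :=
  ∀ A : Set M, Cardinal.mk A < Cardinal.mk M →
    ∀ p : Set (L[[A]].Formula (Fin 1)),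
      (∀ q : Set (L[[A]].Formula (Fin 1)), q ⊆ p → q.Finite →
        ∃ x : M, ∀ φ ∈ q, φ.Realize (fun _ => x)) →
      ∃ x : M, ∀ φ ∈ p, φ.Realize (fun _ => x)

/-- The algebraic closure of `A` in a structure: the elements that lie in some finite
`A`-definable set. -/
def acl {N : Type w} [L.Structure N] (A : Set N) : Set N :=
  {x | ∃ X : Set N, A.Definable₁ L X ∧ X.Finite ∧ x ∈ X}

/-- `X` is weakly normal relative to `A`: it is nonempty, and every point of `X` lies in only
finitely many of the images of `X` under automorphisms fixing `A` pointwise (that is, under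
automorphisms of the expansion by constants for the elements of `A`). -/
def WeaklyNormalRelTo {N : Type w} [L.Structure N] (A X : Set N) : Prop :=
  X.Nonempty ∧ ∀ x ∈ X,
    {Y : Set N | x ∈ Y ∧ ∃ σ : N ≃[L] N, (∀ c ∈ A, σ c = c) ∧ Y = σ '' X}.Finite

/-- `X` is weakly normal: it is nonempty, and every point of `X` lies in only finitely many
of the images of `X` under automorphisms. -/
def WeaklyNormal {N : Type w} [L.Structure N] (X : Set N) : Prop :=
  X.Nonempty ∧ ∀ x ∈ X, {Y : Set N | x ∈ Y ∧ ∃ σ : N ≃[L] N, Y = σ '' X}.Finite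

/-- A sort of imaginaries of `M`: an equivalence relation on `Mⁿ`, for some `n`, that is definable
without parameters. -/
structure ImagSort (M : Type w) [L.Structure M] where
  /-- the length `n` of the tuples -/
  arity : ℕ
  /-- the equivalence relation on `Mⁿ` -/
  rel : Setoid (Fin arity → M)
  definable : ∃ φ : L.Formula (Fin arity ⊕ Fin arity),
    ∀ x y : Fin arity → M, rel x y ↔ φ.Realize (Sum.elim x y)

/-- The universe of `M^eq`: the home sort `M`, together with all quotients `Mⁿ/E` for `E` an
equivalence relation on `Mⁿ` definable without parameters. -/
inductive Meq (M : Type w) [L.Structure M] where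
  | home (a : M) : Meq M
  | cls (S : ImagSort L M) (c : Quotient S.rel) : Meq M

/-- The relation symbols of the language `L^eq` of `M^eq`. -/
inductive EqRel (M : Type w) [L.Structure M] : ℕ → Type (max u v w)
  /-- a predicate for the home sort -/
  | homeSort : EqRel M 1
  /-- a predicate for each sort of imaginaries -/
  | imagSort (S : ImagSort L M) : EqRel M 1
  /-- the relations of `L`, on the home sort -/
  | ofRel {n : ℕ} (R : L.Relations n) : EqRel M n
  /-- the graphs of the functions of `L`, on the home sort -/
  | ofFun {n : ℕ} (f : L.Functions n) : EqRel M (n + 1)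
  /-- the graph of the quotient map `Mⁿ → Mⁿ/E` -/
  | proj (S : ImagSort L M) : EqRel M (S.arity + 1)

/-- The language `L^eq` of `M^eq` (sorts are coded by unary predicates). -/
def Leq (M : Type w) [L.Structure M] : FirstOrder.Language.{0, max u v w} :=
  ⟨fun _ => Empty, EqRel L M⟩

/-- `M^eq` as an `L^eq`-structure. -/
instance Meq.structure (M : Type w) [L.Structure M] : (Leq L M).Structure (Meq L M) where
  funMap := fun f _ => nomatch f
  RelMap := fun r xs =>
    match r, xs with
    | .homeSort, xs => ∃ a : M, xs 0 = .home a
    | .imagSort S, xs => ∃ c : Quotient S.rel, xs 0 = .cls S c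
    | .ofRel R, xs =>
        ∃ v : Fin _ → M, (∀ i, xs i = .home (v i)) ∧ Language.Structure.RelMap R v
    | .ofFun f, xs =>
        ∃ v : Fin _ → M, (∀ i, xs (Fin.castSucc i) = .home (v i)) ∧
          xs (Fin.last _) = .home (Language.Structure.funMap f v)
    | .proj S, xs =>
        ∃ v : Fin S.arity → M, (∀ i, xs (Fin.castSucc i) = .home (v i)) ∧
          xs (Fin.last _) = .cls S (Quotient.mk S.rel v)

end General

section Pseudoplane

variable {M : Type w} [Language.graph.Structure M]

/-- The binary relation `I` of a structure in the language with one binary relation symbol. -/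
def I (x y : M) : Prop := Language.Structure.RelMap Language.adj ![x, y]

variable (M) in
/-- `M` satisfies the axioms of the theory of the free pseudoplane: `I` is symmetric and
irreflexive, every element is related to infinitely many elements, and there are no loops. -/
structure IsFreePseudoplane : Prop where
  symm : ∀ x y : M, I x y → I y x
  irrefl : ∀ x : M, ¬ I x x
  infinite : ∀ a : M, {b : M | I a b}.Infinite
  no_loops : ∀ n : ℕ, 3 ≤ n → ¬ ∃ a : Fin (n + 1) → M,
    (∀ i : Fin n, I (a i.castSucc) (a i.succ)) ∧
      (Function.Injective fun i : Fin n => a i.castSucc) ∧ a 0 = a (Fin.last n)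

/-- The subset of (the home sort of) `M^eq` defined by the formula `I(x, a)`. -/
def nbhd (a : M) : Set (Meq Language.graph M) :=
  {z | ∃ x : M, I x a ∧ z = .home x}

end Pseudoplane

end FreePseudoplane

/-! A model is a forest, and saturation gives every vertex as many neighbours as there are vertices,
even with one neighbour excluded. So all branches at a vertex `x` look alike, and two of them can be
exchanged by an automorphism fixing everything else (`exists_swap`). If the branch at `x` through
`a` misses a finite set `F`, infinitely many other branches at `x` miss `F` too. Swapping with each
of these puts `x` in infinitely many conjugates over `F` of the neighbourhood of `a`
(`infinite_conjugates`). Taking `F` empty gives (i).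

For (ii), let `c` be the class of a tuple `m`; automorphisms fixing `m` fix `c`. Weak normality
relative to `c` then forces the branch through `a` at each neighbour of `a` to meet every
representative of `c`. By saturation this happens within a uniform number `N` of steps
(`exists_mem_hull`), which makes the condition first-order over `c` (`definable_hull`). Only
finitely many vertices satisfy it, since they lie on paths between coordinates of one representative
(`finite_hull`). Hence `a` is algebraic over `c`. -/

namespace FreePseudoplane

/-! ### Bounded reachability avoiding a vertex -/

section Reach

variable {V : Type*}

/-- `Reach A n x a y`: `y` can be reached from `a` in at most `n` steps along `A` that do not
go to `x`. -/
def Reach (A : V → V → Prop) : ℕ → V → V → V → Prop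
  | 0, _, a, y => y = a
  | n + 1, x, a, y => Reach A n x a y ∨ ∃ z, Reach A n x a z ∧ A z y ∧ y ≠ x

lemma Reach.mono {A : V → V → Prop} {m n : ℕ} (h : m ≤ n) {x a y : V} (hr : Reach A m x a y) :
    Reach A n x a y := by
  induction h with
  | refl => exact hr
  | step _ ih => exact Or.inl ih

lemma Reach.exists_walk {G : SimpleGraph V} {n : ℕ} {x a y : V} (hx : a ≠ x)
    (hr : Reach G.Adj n x a y) : ∃ w : G.Walk a y, x ∉ w.support := by
  induction n generalizing y with
  | zero =>
    obtain rfl : y = a := hr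
    exact ⟨.nil, by simpa using hx.symm⟩
  | succ n ih =>
    rcases hr with hr | ⟨z, hr, hz, hy⟩
    · exact ih hr
    · obtain ⟨w, hw⟩ := ih hr
      exact ⟨w.concat hz, by simp [SimpleGraph.Walk.support_concat, hw, hy.symm]⟩

end Reach

/-! ### Labelled branches of a forest and their exchange -/

section Branch

variable {V K : Type*} (e : V → V → K → V)

/-- The last edge of the path that starts with the edge from `x` to `a` and goes on, at each
vertex `v` reached from `p`, to the neighbour `e p v k`, for the successive labels `k` of a list
(read from its end). -/
def branchDart (x a : V) : List K → V × V
  | [] => (x, a)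
  | k :: l => ((branchDart x a l).2, e (branchDart x a l).1 (branchDart x a l).2 k)

/-- The end of the path described by a list of labels. -/
def branchEnd (x a : V) (l : List K) : V := (branchDart e x a l).2

/-- The vertices of the path described by a list of labels. -/
def branchSupport (x a : V) : List K → List V
  | [] => [x, a]
  | k :: l => branchSupport x a l ++ [branchEnd e x a (k :: l)]

/-- `e p v` enumerates without repetition the neighbours of `v` other than `p`. -/
def IsChildEnum (G : SimpleGraph V) : Prop :=
  ∀ p v, Function.Injective (e p v) ∧ ∀ y, (∃ k, e p v k = y) ↔ G.Adj v y ∧ y ≠ p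

variable {e} {G : SimpleGraph V}

lemma length_branchSupport (x a : V) (l : List K) :
    (branchSupport e x a l).length = l.length + 2 := by
  induction l with
  | nil => rfl
  | cons k l ih => simp [branchSupport, ih]

/-- In a forest, a neighbour of the end of a path that already lies on the path must be the
penultimate vertex. Children exclude that vertex, so each extension is again a path. -/
lemma exists_branch_path (hG : G.IsAcyclic) (he : IsChildEnum e G) {x a : V} (hxa : G.Adj x a)
    (l : List K) : ∃ w : G.Walk x (branchEnd e x a l), w.IsPath ∧
      w.penultimate = (branchDart e x a l).1 ∧ w.support = branchSupport e x a l := by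
  induction l with
  | nil =>
    change ∃ w : G.Walk x a, w.IsPath ∧ w.penultimate = x ∧ w.support = [x, a]
    exact ⟨.cons hxa .nil,
      (SimpleGraph.Walk.cons_isPath_iff _ _).2 ⟨.nil, by simpa using hxa.ne⟩, rfl, rfl⟩
  | cons k l ih =>
    obtain ⟨w, hw, hp, hs⟩ := ih
    obtain ⟨hadj, hne⟩ : G.Adj (branchEnd e x a l) (branchEnd e x a (k :: l)) ∧
        branchEnd e x a (k :: l) ≠ (branchDart e x a l).1 :=
      ((he (branchDart e x a l).1 (branchDart e x a l).2).2 _).1 ⟨k, rfl⟩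
    refine ⟨w.concat hadj, hw.concat ?_ _, ?_, ?_⟩
    · intro hmem
      exact hne ((hG.eq_penultimate_of_adj_end hw hadj hmem).trans hp)
    · rw [SimpleGraph.Walk.penultimate_concat]
      rfl
    · rw [SimpleGraph.Walk.support_concat, hs]
      rfl

lemma branchSupport_inj (he : IsChildEnum e G) {x a b : V} {l l' : List K}
    (h : branchSupport e x a l = branchSupport e x b l') : a = b ∧ l = l' := by
  induction l generalizing l' with
  | nil =>
    cases l' with
    | nil => simpa [branchSupport] using h
    | cons k' l' => simpa [length_branchSupport] using congrArg List.length h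
  | cons k l ih =>
    cases l' with
    | nil => simpa [length_branchSupport] using congrArg List.length h
    | cons k' l' =>
      obtain ⟨h1, h2⟩ := List.append_inj' h rfl
      obtain ⟨rfl, rfl⟩ := ih h1
      have h3 : e _ _ k = e _ _ k' := List.singleton_injective h2
      exact ⟨rfl, by rw [(he _ _).1 h3]⟩

/-- Paths in a forest are unique, so the end determines the support, and the support determines the
labels. -/
lemma branchEnd_inj (hG : G.IsAcyclic) (he : IsChildEnum e G) {x a b : V} (ha : G.Adj x a)
    (hb : G.Adj x b) {l l' : List K} (h : branchEnd e x a l = branchEnd e x b l') :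
    a = b ∧ l = l' := by
  obtain ⟨w, hw, -, hs⟩ := exists_branch_path hG he ha l
  obtain ⟨w', hw', -, hs'⟩ := exists_branch_path hG he hb l'
  apply branchSupport_inj he
  rw [← hs, ← hs']
  generalize branchEnd e x a l = y at *
  subst h
  exact congrArg (fun p : G.Path _ _ => p.1.support) ((hG.subsingleton_path _ _).elim ⟨w, hw⟩ ⟨w', hw'⟩)

lemma branchEnd_ne (hG : G.IsAcyclic) (he : IsChildEnum e G) {x a : V} (ha : G.Adj x a)
    (l : List K) : branchEnd e x a l ≠ x := by
  intro h
  obtain ⟨w, hw, -, hs⟩ := exists_branch_path hG he ha l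
  have h2 := length_branchSupport (e := e) x a l
  rw [← hs] at h2
  generalize branchEnd e x a l = y at *
  subst h
  rw [SimpleGraph.Walk.isPath_iff_nil] at hw
  simp [SimpleGraph.Walk.nil_iff_support_eq.1 hw] at h2

lemma adj_branchEnd_cons (he : IsChildEnum e G) (x a : V) (k : K) (l : List K) :
    G.Adj (branchEnd e x a l) (branchEnd e x a (k :: l)) :=
  (((he _ _).2 _).1 ⟨k, rfl⟩).1

/-- A branch is joined to the rest of the graph only by its edge to `x`; this is why exchanging
branches preserves adjacency. -/
lemma adj_branchEnd (he : IsChildEnum e G) {x a v : V} {l : List K}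
    (h : G.Adj (branchEnd e x a l) v) :
    (l = [] ∧ v = x) ∨ (∃ k l', l = k :: l' ∧ v = branchEnd e x a l') ∨
      ∃ k, v = branchEnd e x a (k :: l) := by
  by_cases hv : v = (branchDart e x a l).1
  · cases l with
    | nil => exact Or.inl ⟨rfl, hv⟩
    | cons k l => exact Or.inr (Or.inl ⟨k, l, rfl, hv⟩)
  · obtain ⟨k, hk⟩ := ((he (branchDart e x a l).1 _).2 v).2 ⟨h, hv⟩
    exact Or.inr (Or.inr ⟨k, hk.symm⟩)

lemma exists_reach_branchEnd (hG : G.IsAcyclic) (he : IsChildEnum e G) {x a : V}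
    (ha : G.Adj x a) (l : List K) : ∃ n, Reach G.Adj n x a (branchEnd e x a l) := by
  induction l with
  | nil => exact ⟨0, rfl⟩
  | cons k l ih =>
    obtain ⟨n, hn⟩ := ih
    exact ⟨n + 1, Or.inr ⟨_, hn, adj_branchEnd_cons he x a k l, branchEnd_ne hG he ha _⟩⟩

/-- In a forest all of whose branches are labelled by the same set, two branches at a vertex can
be exchanged by an automorphism that fixes everything else. -/
lemma exists_swap (hG : G.IsAcyclic) (he : IsChildEnum e G) {x a b : V} (ha : G.Adj x a)
    (hb : G.Adj x b) (hab : a ≠ b) :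
    ∃ σ : G ≃g G, σ x = x ∧ σ a = b ∧
      ∀ y, (∀ l, branchEnd e x a l ≠ y) → (∀ l, branchEnd e x b l ≠ y) → σ y = y := by
  classical
  -- Vertices with the same label list are exchanged; `branchEnd_inj` makes the chosen list unique
  -- and the two branches disjoint.
  let s : V → V := fun y =>
    if h : ∃ l, branchEnd e x a l = y then branchEnd e x b h.choose
    else if h : ∃ l, branchEnd e x b l = y then branchEnd e x a h.choose
    else y
  have hsa : ∀ l, s (branchEnd e x a l) = branchEnd e x b l := by
    intro l
    have h : ∃ l', branchEnd e x a l' = branchEnd e x a l := ⟨l, rfl⟩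
    simp only [s, dif_pos h]
    rw [(branchEnd_inj hG he ha ha h.choose_spec).2]
  have hsb : ∀ l, s (branchEnd e x b l) = branchEnd e x a l := by
    intro l
    have h : ∃ l', branchEnd e x b l' = branchEnd e x b l := ⟨l, rfl⟩
    have h' : ¬ ∃ l', branchEnd e x a l' = branchEnd e x b l := fun ⟨l', hl'⟩ =>
      hab (branchEnd_inj hG he ha hb hl').1
    simp only [s, dif_neg h', dif_pos h]
    rw [(branchEnd_inj hG he hb hb h.choose_spec).2]
  have hs : ∀ y, (∀ l, branchEnd e x a l ≠ y) → (∀ l, branchEnd e x b l ≠ y) → s y = y := by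
    intro y h1 h2
    simp only [s]
    rw [dif_neg (by simpa using h1), dif_neg (by simpa using h2)]
  have hsx : s x = x := hs x (branchEnd_ne hG he ha) (branchEnd_ne hG he hb)
  have hcases : ∀ y, (∃ l, y = branchEnd e x a l) ∨ (∃ l, y = branchEnd e x b l) ∨ s y = y := by
    intro y
    by_cases h1 : ∃ l, y = branchEnd e x a l
    · exact Or.inl h1
    by_cases h2 : ∃ l, y = branchEnd e x b l
    · exact Or.inr (Or.inl h2)
    exact Or.inr (Or.inr (hs y (fun l h => h1 ⟨l, h.symm⟩) fun l h => h2 ⟨l, h.symm⟩))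
  have hinv : Function.Involutive s := by
    intro y
    rcases hcases y with ⟨l, rfl⟩ | ⟨l, rfl⟩ | h
    · rw [hsa, hsb]
    · rw [hsb, hsa]
    · rw [h, h]
  have key : ∀ c d, G.Adj x d → (∀ l, s (branchEnd e x c l) = branchEnd e x d l) →
      ∀ l v, G.Adj (branchEnd e x c l) v → G.Adj (s (branchEnd e x c l)) (s v) := by
    intro c d hd hcd l v hv
    rcases adj_branchEnd he hv with ⟨rfl, rfl⟩ | ⟨k, l', rfl, rfl⟩ | ⟨k, rfl⟩
    · rw [hcd, hsx]
      exact hd.symm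
    · rw [hcd, hcd]
      exact (adj_branchEnd_cons he _ _ _ _).symm
    · rw [hcd, hcd]
      exact adj_branchEnd_cons he _ _ _ _
  have hadj : ∀ u v, G.Adj u v → G.Adj (s u) (s v) := by
    intro u v h
    rcases hcases u with ⟨l, rfl⟩ | ⟨l, rfl⟩ | hu
    · exact key a b hb hsa l v h
    · exact key b a ha hsb l v h
    rcases hcases v with ⟨l, rfl⟩ | ⟨l, rfl⟩ | hv
    · exact (key a b hb hsa l u h.symm).symm
    · exact (key b a ha hsb l u h.symm).symm
    rwa [hu, hv]
  -- For an involution, preserving adjacency also yields reflecting it.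
  refine ⟨⟨hinv.toPerm s, fun {u v} => ⟨fun h => ?_, hadj u v⟩⟩, hsx, hsa [], hs⟩
  have := hadj _ _ h
  simpa [hinv u, hinv v] using this

/-- Each point of `F` lies in at most one branch at `x`. -/
lemma infinite_branch_avoids (hG : G.IsAcyclic) (he : IsChildEnum e G) {x : V}
    (hx : {b | G.Adj x b}.Infinite) {F : Set V} (hF : F.Finite) :
    {b | G.Adj x b ∧ ∀ y ∈ F, ∀ l, branchEnd e x b l ≠ y}.Infinite := by
  have hfin : (⋃ y ∈ F, {b | G.Adj x b ∧ ∃ l, branchEnd e x b l = y}).Finite := by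
    refine hF.biUnion fun y _ => Set.Subsingleton.finite ?_
    rintro b ⟨hb, l, hl⟩ c ⟨hc, l', hl'⟩
    exact (branchEnd_inj hG he hb hc (hl.trans hl'.symm)).1
  refine (hx.sdiff hfin).mono ?_
  rintro b ⟨hb, hb'⟩
  refine ⟨hb, fun y hy l hl => hb' ?_⟩
  simp only [Set.mem_iUnion]
  exact ⟨y, hy, hb, l, hl⟩

end Branch

/-! ### Finiteness of the hull of a finite family -/

section Hull

variable {V : Type*} {G : SimpleGraph V}

/-- In a forest, the vertices that cannot be separated from the finite family `m` by deleting one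
of their neighbours lie on the paths between members of `m`. -/
lemma finite_hull (hG : G.IsAcyclic) (hinf : ∀ a, {b | G.Adj a b}.Infinite) {ι : Type*} [Finite ι]
    (m : ι → V) (n : ℕ) : {a | ∀ x, G.Adj x a → ∃ i, Reach G.Adj n x a (m i)}.Finite := by
  classical
  have hpath : ∀ u v, {a | ∃ r : G.Walk u v, r.IsPath ∧ a ∈ r.support}.Finite := by
    intro u v
    by_cases h : ∃ r : G.Walk u v, r.IsPath
    · obtain ⟨r, hr⟩ := h
      refine r.support.toFinset.finite_toSet.subset ?_
      rintro a ⟨r', hr', ha⟩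
      obtain rfl : r' = r := congrArg Subtype.val ((hG.subsingleton_path _ _).elim ⟨r', hr'⟩ ⟨r, hr⟩)
      simpa using ha
    · refine Set.finite_empty.subset ?_
      rintro a ⟨r, hr, -⟩
      exact h ⟨r, hr⟩
  refine (Set.finite_iUnion fun i => Set.finite_iUnion fun j => hpath (m i) (m j)).subset ?_
  intro a ha
  obtain ⟨x₀, hx₀⟩ := (hinf a).nonempty
  obtain ⟨i, hi⟩ := ha x₀ (SimpleGraph.Adj.symm hx₀)
  obtain ⟨w, -⟩ := hi.exists_walk (SimpleGraph.Adj.ne hx₀)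
  simp only [Set.mem_iUnion]
  obtain ⟨p, hp⟩ : ∃ p : G.Walk a (m i), p.IsPath := ⟨w.bypass, w.bypass_isPath⟩
  generalize hu : m i = u at *
  cases p with
  | nil => exact ⟨i, i, .nil, .nil, by simp [hu]⟩
  -- Here `x` is the first vertex after `a` on the path to `m i`. The hypothesis for this `x` gives
  -- some `m j` reached from `a` while avoiding `x`, so `a` should lie between `m i` and `m j`.
  | @cons _ x _ hax p =>
    obtain ⟨j, hj⟩ := ha x hax.symm
    obtain ⟨q, hq⟩ := hj.exists_walk hax.ne
    have hp' : a ∉ p.support := (SimpleGraph.Walk.cons_isPath_iff _ _).1 hp |>.2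
    let r := (p.reverse.append ((SimpleGraph.Walk.cons hax.symm .nil).append q)).bypass
    refine ⟨i, j, r.copy hu.symm rfl, by simpa using SimpleGraph.Walk.bypass_isPath _, ?_⟩
    -- The edge between `a` and `x` is a bridge, so the closed-up walk from `a` to `x` must use it.
    -- Since `q` misses `x` and `p` misses `a`, it is `r` that uses it.
    have hbr := SimpleGraph.isAcyclic_iff_forall_adj_isBridge.1 hG hax
    rw [SimpleGraph.isBridge_iff_forall_walk_mem_edges] at hbr
    have := hbr (q.append (r.reverse.append p.reverse))
    simp only [SimpleGraph.Walk.edges_append, SimpleGraph.Walk.edges_reverse, List.mem_append,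
      List.mem_reverse] at this
    rcases this with h | h | h
    · exact absurd (q.snd_mem_support_of_mem_edges h) hq
    · simpa using r.fst_mem_support_of_mem_edges h
    · exact absurd (p.fst_mem_support_of_mem_edges h) hp'

end Hull

/-! ### Saturation for tuples -/

section Saturation

universe u v w

variable {L : FirstOrder.Language.{u, v}} {M : Type w} [L.Structure M]

lemma realize_constantsVarsEquiv_symm {A : Set M} {β : Type*} (φ : L.Formula (A ⊕ β))
    (x : β → M) :
    Language.Formula.Realize (L := L[[A]])
      (Language.BoundedFormula.constantsVarsEquiv.symm φ : L[[A]].Formula β) x ↔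
      φ.Realize (Sum.elim (↑) x) := by
  have h := Language.BoundedFormula.realize_constantsVarsEquiv (L := L) (α := A) (M := M)
    (φ := Language.BoundedFormula.constantsVarsEquiv.symm φ) (v := x) (xs := default)
  rw [Equiv.apply_symm_apply] at h
  exact h.symm

/-- Saturation for families of formulas with free variables in place of parameters. -/
lemma IsSaturated.exists_realize (hM : IsSaturated L M) {A : Set M}
    (hA : Cardinal.mk A < Cardinal.mk M) {ι : Type*} (φ : ι → L.Formula (A ⊕ Fin 1))
    (h : ∀ s : Finset ι, ∃ x : M, ∀ i ∈ s, (φ i).Realize (Sum.elim (↑) fun _ => x)) :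
    ∃ x : M, ∀ i, (φ i).Realize (Sum.elim (↑) fun _ => x) := by
  classical
  obtain ⟨x, hx⟩ := hM A hA
    (Set.range fun i => (Language.BoundedFormula.constantsVarsEquiv.symm (φ i) :)) (by
      intro q hq hfin
      choose g hg using hq
      obtain ⟨x, hx⟩ := h (hfin.toFinset.attach.image fun ψ => g (hfin.mem_toFinset.1 ψ.2))
      refine ⟨x, fun ψ hψ => ?_⟩
      rw [← hg hψ]
      exact (realize_constantsVarsEquiv_symm _ _).2 (hx _ (Finset.mem_image.2
        ⟨⟨ψ, hfin.mem_toFinset.2 hψ⟩, Finset.mem_attach _ _, rfl⟩)))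
  exact ⟨x, fun i => (realize_constantsVarsEquiv_symm _ _).1 (hx _ ⟨i, rfl⟩)⟩

/-- In an infinite saturated structure, a decreasing sequence of nonempty sets of `n`-tuples,
definable over finitely many parameters, has nonempty intersection. -/
lemma IsSaturated.exists_forall_realize [Infinite M] (hM : IsSaturated L M) {n : ℕ}
    {α : Type*} [Finite α] (v : α → M) (φ : ℕ → L.Formula (α ⊕ Fin n))
    (hanti : ∀ i j, i ≤ j → ∀ x : Fin n → M,
      (φ j).Realize (Sum.elim v x) → (φ i).Realize (Sum.elim v x))
    (hne : ∀ i, ∃ x : Fin n → M, (φ i).Realize (Sum.elim v x)) :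
    ∃ x : Fin n → M, ∀ i, (φ i).Realize (Sum.elim v x) := by
  -- Saturation concerns one variable, so coordinates are chosen one at a time and each becomes a
  -- parameter for the next. Monotonicity reduces finite satisfiability to the largest index.
  induction n generalizing α with
  | zero =>
    refine ⟨default, fun i => ?_⟩
    obtain ⟨x, hx⟩ := hne i
    rwa [Subsingleton.elim default x]
  | succ n ih =>
    let g : α ⊕ Fin (n + 1) → (α ⊕ Fin 1) ⊕ Fin n :=
      Sum.elim (fun a => .inl (.inl a)) (Fin.cases (.inl (.inr 0)) fun j => .inr j)
    have hg : ∀ (x : M) (y : Fin n → M),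
        Sum.elim (Sum.elim v fun _ => x) y ∘ g = Sum.elim v (Fin.cons x y) := by
      intro x y
      funext i
      rcases i with a | i
      · rfl
      · refine Fin.cases ?_ (fun j => ?_) i <;> simp [g]
    have hψ : ∀ i (x : M) (y : Fin n → M),
        ((φ i).relabel g).Realize (Sum.elim (Sum.elim v fun _ => x) y) ↔
          (φ i).Realize (Sum.elim v (Fin.cons x y)) := by
      intro i x y
      rw [Language.Formula.realize_relabel, hg]
    let c : α ⊕ Fin 1 → (Set.range v) ⊕ Fin 1 := Sum.map (Set.rangeFactorization v) id
    have hc : ∀ x : M, Sum.elim ((↑) : Set.range v → M) (fun _ => x) ∘ c =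
        Sum.elim v fun _ => x := by
      intro x
      funext i
      rcases i with a | i <;> rfl
    have hθ : ∀ i (x : M),
        ((((φ i).relabel g).iExs (Fin n)).relabel c).Realize
            (Sum.elim ((↑) : Set.range v → M) fun _ => x) ↔
          ∃ y : Fin n → M, (φ i).Realize (Sum.elim v (Fin.cons x y)) := by
      intro i x
      rw [Language.Formula.realize_relabel, hc, Language.Formula.realize_iExs]
      exact exists_congr fun y => hψ i x y
    obtain ⟨x, hx⟩ := hM.exists_realize
      ((Cardinal.lt_aleph0_of_finite _).trans_le (Cardinal.aleph0_le_mk M))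
      (fun i => (((φ i).relabel g).iExs (Fin n)).relabel c) (by
        intro s
        obtain ⟨z, hz⟩ := hne (s.sup id)
        refine ⟨z 0, fun i hi => (hθ _ _).2 ⟨Fin.tail z, ?_⟩⟩
        rw [Fin.cons_self_tail]
        exact hanti i _ (Finset.le_sup (f := id) hi) z hz)
    obtain ⟨y, hy⟩ := ih (Sum.elim v fun _ => x) (fun i => (φ i).relabel g)
      (fun i j hij y hj => (hψ _ _ _).2 (hanti i j hij _ ((hψ _ _ _).1 hj)))
      (fun i => by
        obtain ⟨y, hy⟩ := (hθ i x).1 (hx i)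
        exact ⟨y, (hψ _ _ _).2 hy⟩)
    exact ⟨Fin.cons x y, fun i => (hψ _ _ _).1 (hy i)⟩

end Saturation

/-! ### First-order definability of bounded reachability -/

section ReachFormula

universe u v w

variable {L : FirstOrder.Language.{u, v}} (r : L.Relations 2)

/-- The formula that defines `Reach`. -/
noncomputable def reachFormula : ℕ → L.Formula (Fin 3)
  | 0 => (Language.Term.var 2).equal (Language.Term.var 1)
  | n + 1 => reachFormula n ⊔ Language.Formula.iExs (Fin 1)
      (((reachFormula n).relabel ![Sum.inl 0, Sum.inl 1, Sum.inr 0]) ⊓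
        (r.formula₂ (Language.Term.var (Sum.inr 0)) (Language.Term.var (Sum.inl 2)) ⊓
          ∼((Language.Term.var (Sum.inl 2)).equal (Language.Term.var (Sum.inl 0)))))

lemma realize_reachFormula {N : Type w} [L.Structure N] (n : ℕ) (v : Fin 3 → N) :
    (reachFormula r n).Realize v ↔
      Reach (fun x y => Language.Structure.RelMap r ![x, y]) n (v 0) (v 1) (v 2) := by
  induction n generalizing v with
  | zero => simp [reachFormula, Reach]
  | succ n ih =>
    simp only [reachFormula, Reach, Language.Formula.realize_sup, Language.Formula.realize_iExs,
      Language.Formula.realize_inf, Language.Formula.realize_relabel, ih,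
      Language.Formula.realize_rel₂, Language.Formula.realize_not, Language.Formula.realize_equal,
      Language.Term.realize_var, Sum.elim_inl, Sum.elim_inr, Function.comp_apply, ne_eq,
      Matrix.cons_val_zero, Matrix.cons_val_one, Matrix.cons_val]
    refine or_congr_right ⟨fun ⟨i, hi⟩ => ⟨i 0, hi⟩, fun ⟨z, hz⟩ => ⟨fun _ => z, hz⟩⟩

end ReachFormula

/-! ### Saturated free pseudoplanes as regular forests -/

section Pseudoplane

universe w

variable {M : Type w} [Language.graph.Structure M]

/-- The graph of a free pseudoplane. -/
def IsFreePseudoplane.toGraph (hT : IsFreePseudoplane M) : SimpleGraph M where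
  Adj := I
  symm := ⟨hT.symm⟩
  loopless := ⟨hT.irrefl⟩

lemma IsFreePseudoplane.isAcyclic (hT : IsFreePseudoplane M) : hT.toGraph.IsAcyclic := by
  intro v c hc
  refine hT.no_loops c.length hc.three_le_length ⟨fun i => c.getVert i, ?_, ?_, ?_⟩
  · intro i
    exact c.adj_getVert_succ i.2
  · intro i j hij
    have hi := i.2
    have hj := j.2
    exact Fin.ext (hc.getVert_injOn' (by simp only [Set.mem_ofPred_eq]; omega)
      (by simp only [Set.mem_ofPred_eq]; omega) hij)
  · simp

lemma IsFreePseudoplane.infinite_univ (hT : IsFreePseudoplane M) (a : M) : Infinite M :=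
  Set.infinite_univ_iff.1 ((hT.infinite a).mono (Set.subset_univ _))

/-- In a saturated free pseudoplane, every vertex has as many neighbours as there are vertices. -/
lemma IsFreePseudoplane.mk_children (hT : IsFreePseudoplane M)
    (hM : IsSaturated Language.graph M) (p v : M) :
    Cardinal.mk {y | I v y ∧ y ≠ p} = Cardinal.mk M := by
  have := hT.infinite_univ v
  refine (Cardinal.mk_set_le _).antisymm (not_lt.1 fun hlt => ?_)
  -- Were there too few children, a neighbour of `v` outside `A` would be finitely satisfiable over
  -- the small set `A`, hence realized, which is absurd.
  let A : Set M := {y | I v y ∧ y ≠ p} ∪ {v, p}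
  have hA : Cardinal.mk A < Cardinal.mk M :=
    (Cardinal.mk_union_le _ _).trans_lt (Cardinal.add_lt_of_lt (Cardinal.aleph0_le_mk M) hlt
      ((Cardinal.lt_aleph0_of_finite _).trans_le (Cardinal.aleph0_le_mk M)))
  have hv : v ∈ A := Or.inr (Or.inl rfl)
  have hp : p ∈ A := Or.inr (Or.inr rfl)
  obtain ⟨x, hx⟩ := hM.exists_realize hA
    (fun i : Option A => i.elim
      (Language.adj.formula₂ (Language.Term.var (Sum.inl ⟨v, hv⟩)) (Language.Term.var (Sum.inr 0)))
      fun b => ∼((Language.Term.var (Sum.inr 0)).equal (Language.Term.var (Sum.inl b)))) (by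
    intro s
    classical
    obtain ⟨x, hx, hxs⟩ := ((hT.infinite v).sdiff
      ((s.eraseNone.image ((↑) : A → M)).finite_toSet)).nonempty
    refine ⟨x, fun i hi => ?_⟩
    rcases i with _ | b
    · simpa [I] using hx
    · simp only [Option.elim_some, Language.Formula.realize_not, Language.Formula.realize_equal,
        Language.Term.realize_var, Sum.elim_inl, Sum.elim_inr]
      rintro rfl
      exact hxs (Finset.mem_coe.2 (Finset.mem_image.2 ⟨b, by simpa using hi, rfl⟩)))
  have hvx : I v x := by simpa [I] using hx none
  have hne : ∀ b : A, x ≠ b := fun b => by simpa using hx (some b)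
  exact hne ⟨x, Or.inl ⟨hvx, hne ⟨p, hp⟩⟩⟩ rfl

/-- `M` itself serves as a common label set for the children at every vertex. -/
lemma IsFreePseudoplane.exists_isChildEnum (hT : IsFreePseudoplane M)
    (hM : IsSaturated Language.graph M) : ∃ e : M → M → M → M, IsChildEnum e hT.toGraph := by
  have h : ∀ p v, Nonempty (M ≃ {y | I v y ∧ y ≠ p}) := fun p v =>
    Cardinal.eq.1 (hT.mk_children hM p v).symm
  refine ⟨fun p v k => (h p v).some k, fun p v =>
    ⟨Subtype.val_injective.comp (h p v).some.injective, fun y => ⟨?_, fun hy => ?_⟩⟩⟩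
  · rintro ⟨k, rfl⟩
    exact ((h p v).some k).2
  · exact ⟨(h p v).some.symm ⟨y, hy⟩, by simp⟩

/-- Two vertices with the same neighbours are equal. -/
lemma IsFreePseudoplane.nbhd_injective (hT : IsFreePseudoplane M) :
    Function.Injective (nbhd : M → Set (Meq Language.graph M)) := by
  intro a b hab
  by_contra hne
  have hI : ∀ x, I a x → I b x := by
    intro x hx
    obtain ⟨y, hy, hxy⟩ : Meq.home x ∈ nbhd b := hab ▸ ⟨x, hT.symm _ _ hx, rfl⟩
    cases hxy
    exact hT.symm _ _ hy
  -- Each common neighbour is the midpoint of a path from `a` to `b`, and a forest has at most one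
  -- such path.
  have hpath : ∀ x, ∀ h : I a x, ∃ p : hT.toGraph.Walk a b, p.IsPath ∧ p.snd = x := by
    intro x h
    have h1 : hT.toGraph.Adj a x := h
    have h2 : hT.toGraph.Adj x b := hT.symm _ _ (hI x h)
    exact ⟨.cons h1 (.cons h2 .nil), by simp [h1.ne, h2.ne, hne], rfl⟩
  refine hT.infinite a (Set.Subsingleton.finite fun x hx y hy => ?_)
  obtain ⟨p, hp, rfl⟩ := hpath x hx
  obtain ⟨q, hq, rfl⟩ := hpath y hy
  exact congrArg (fun p : hT.toGraph.Path a b => p.1.snd)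
    ((hT.isAcyclic.subsingleton_path a b).elim ⟨p, hp⟩ ⟨q, hq⟩)

end Pseudoplane

/-! ### Extending automorphisms to the imaginaries -/

section Lift

universe u v w

variable {L : FirstOrder.Language.{u, v}} {M : Type w} [L.Structure M]

lemma ImagSort.rel_comp (S : ImagSort L M) (σ : M ≃[L] M) {x y : Fin S.arity → M}
    (h : S.rel x y) : S.rel (σ ∘ x) (σ ∘ y) := by
  obtain ⟨φ, hφ⟩ := S.definable
  rw [hφ] at h ⊢
  rw [← Sum.comp_elim]
  exact (Language.StrongHomClass.realize_formula σ φ).2 h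

/-- The map on `M^eq` induced by an automorphism of `M`. -/
def Meq.map (σ : M ≃[L] M) : Meq L M → Meq L M
  | .home a => .home (σ a)
  | .cls S c => .cls S (Quotient.map (fun x => σ ∘ x) (fun _ _ h => S.rel_comp σ h) c)

lemma Meq.map_symm_map (σ : M ≃[L] M) (z : Meq L M) : Meq.map σ.symm (Meq.map σ z) = z := by
  rcases z with a | ⟨S, c⟩
  · simp [Meq.map]
  · induction c using Quotient.inductionOn with
    | h x =>
      simp only [Meq.map, Quotient.map_mk]
      congr 2
      funext i
      simp

lemma Meq.relMap_map (σ : M ≃[L] M) {n : ℕ} (r : (Leq L M).Relations n) (xs : Fin n → Meq L M)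
    (h : Language.Structure.RelMap r xs) :
    Language.Structure.RelMap r (Meq.map σ ∘ xs) := by
  cases r with
  | homeSort =>
    obtain ⟨a, ha⟩ := h
    exact ⟨σ a, by simp [ha, Meq.map]⟩
  | imagSort S =>
    obtain ⟨c, hc⟩ := h
    exact ⟨_, (congrArg (Meq.map σ) hc).trans rfl⟩
  | ofRel R =>
    obtain ⟨v, hv, hR⟩ := h
    exact ⟨σ ∘ v, fun i => by simp [hv, Meq.map], (σ.map_rel R v).2 hR⟩
  | ofFun f =>
    obtain ⟨v, hv, hf⟩ := h
    exact ⟨σ ∘ v, fun i => by simp [hv, Meq.map], by simp [hf, Meq.map, σ.map_fun]⟩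
  | proj S =>
    obtain ⟨v, hv, hS⟩ := h
    exact ⟨σ ∘ v, fun i => by simp [hv, Meq.map], by simp [hS, Meq.map]⟩

/-- The automorphism of `M^eq` induced by an automorphism of `M`. -/
def Meq.mapEquiv (σ : M ≃[L] M) : Meq L M ≃[Leq L M] Meq L M where
  toFun := Meq.map σ
  invFun := Meq.map σ.symm
  left_inv := Meq.map_symm_map σ
  right_inv := Meq.map_symm_map σ.symm
  map_fun' := fun f _ => nomatch f
  map_rel' := fun r xs => by
    refine ⟨fun h => ?_, Meq.relMap_map σ r xs⟩
    have h' := Meq.relMap_map σ.symm r _ h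
    have hxs : Meq.map σ.symm ∘ Meq.map σ ∘ xs = xs := funext fun i => Meq.map_symm_map σ (xs i)
    exact hxs ▸ h'

end Lift

/-! ### Conjugates of neighbourhoods, definable hulls, algebraicity -/

section Pseudoplane

universe w

variable {M : Type w} [Language.graph.Structure M]

/-- An automorphism of the graph of a free pseudoplane as an automorphism of the structure. -/
def IsFreePseudoplane.autOfIso (hT : IsFreePseudoplane M) (ρ : hT.toGraph ≃g hT.toGraph) :
    M ≃[Language.graph] M where
  toEquiv := ρ.toEquiv
  map_fun' := fun f _ => nomatch f
  map_rel' := fun r xs => by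
    cases r with
    | adj =>
      have h : ∀ ys : Fin 2 → M, Language.Structure.RelMap Language.adj ys ↔ I (ys 0) (ys 1) := by
        intro ys
        rw [I]
        exact iff_of_eq (congrArg _ (funext fun i => by fin_cases i <;> rfl))
      exact (h _).trans ((ρ.map_rel_iff (a := xs 0) (b := xs 1)).trans (h xs).symm)

lemma I_map_iff (σ : M ≃[Language.graph] M) (x y : M) : I (σ x) (σ y) ↔ I x y := by
  rw [I, I, ← σ.map_rel Language.adj ![x, y] ]
  exact iff_of_eq (congrArg _ (funext fun i => by fin_cases i <;> rfl))

lemma mapEquiv_image_nbhd (σ : M ≃[Language.graph] M) (a : M) :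
    Meq.mapEquiv σ '' nbhd a = nbhd (σ a) := by
  ext z
  constructor
  · rintro ⟨_, ⟨x, hx, rfl⟩, rfl⟩
    exact ⟨σ x, (I_map_iff σ x a).2 hx, rfl⟩
  · rintro ⟨y, hy, rfl⟩
    obtain ⟨x, rfl⟩ := σ.surjective y
    exact ⟨.home x, ⟨x, (I_map_iff σ x a).1 hy, rfl⟩, rfl⟩

/-- If the branch at `x` through `a` avoids a finite set `F`, then `x` lies in infinitely many
conjugates over `F` of the neighbourhood of `a`. -/
lemma IsFreePseudoplane.infinite_conjugates (hT : IsFreePseudoplane M) {e : M → M → M → M}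
    (he : IsChildEnum e hT.toGraph) {x a : M} (hxa : I x a) {F : Set M} (hF : F.Finite)
    (havoid : ∀ y ∈ F, ∀ l, branchEnd e x a l ≠ y) :
    {Y : Set (Meq Language.graph M) | Meq.home x ∈ Y ∧ ∃ σ : M ≃[Language.graph] M,
      (∀ y ∈ F, σ y = y) ∧ Y = Meq.mapEquiv σ '' nbhd a}.Infinite := by
  have hinf := (infinite_branch_avoids hT.isAcyclic he (hT.infinite x) hF).sdiff
    (Set.finite_singleton a)
  refine (hinf.image hT.nbhd_injective.injOn).mono ?_
  rintro _ ⟨b, ⟨⟨hxb, hb⟩, hba⟩, rfl⟩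
  obtain ⟨ρ, -, hρ, hfix⟩ := exists_swap hT.isAcyclic he hxa hxb (Ne.symm hba)
  refine ⟨⟨x, hxb, rfl⟩, hT.autOfIso ρ, fun y hy => hfix y (havoid y hy) (hb y hy), ?_⟩
  rw [mapEquiv_image_nbhd]
  exact congrArg nbhd hρ.symm

lemma relMap_ofRel_adj (x y : Meq Language.graph M) :
    Language.Structure.RelMap (L := Leq Language.graph M) (EqRel.ofRel Language.adj) ![x, y] ↔
      ∃ u v : M, x = .home u ∧ y = .home v ∧ I u v := by
  constructor
  · rintro ⟨v, hv, hR⟩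
    refine ⟨v 0, v 1, hv 0, hv 1, ?_⟩
    rw [I]
    convert hR using 1
    funext i
    fin_cases i <;> rfl
  · rintro ⟨u, v, rfl, rfl, h⟩
    exact ⟨![u, v], fun i => by fin_cases i <;> rfl, h⟩

/-- The relation holds only between home elements, so reachability computed in `Meq` never leaves
the home sort. -/
lemma reach_home_iff (n : ℕ) (x a : M) (z : Meq Language.graph M) :
    Reach (fun x y => Language.Structure.RelMap (L := Leq Language.graph M)
      (EqRel.ofRel Language.adj) ![x, y]) n (.home x) (.home a) z ↔
      ∃ y, z = .home y ∧ Reach I n x a y := by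
  induction n generalizing z with
  | zero => simp [Reach]
  | succ n ih =>
    simp only [Reach, ih]
    constructor
    · rintro (⟨y, rfl, h⟩ | ⟨_, ⟨y, rfl, h⟩, hadj, hne⟩)
      · exact ⟨y, rfl, Or.inl h⟩
      · obtain ⟨u, v, hu, rfl, huv⟩ := (relMap_ofRel_adj _ _).1 hadj
        cases hu
        exact ⟨v, rfl, Or.inr ⟨y, h, huv, fun h => hne (congrArg _ h)⟩⟩
    · rintro ⟨y, rfl, h | ⟨u, h, huy, hne⟩⟩
      · exact Or.inl ⟨y, rfl, h⟩
      · exact Or.inr ⟨.home u, ⟨u, rfl, h⟩,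
          (relMap_ofRel_adj _ _).2 ⟨u, y, rfl, rfl, huy⟩, fun h => hne (by cases h; rfl)⟩

/-- The set of vertices `a` such that every `m ∈ C` meets, within `N` steps from `a`, each branch
at a neighbour of `a` through `a`. -/
def hull {n : ℕ} (C : Set (Fin n → M)) (N : ℕ) : Set M :=
  {a | ∀ m ∈ C, ∀ x, I x a → ∃ i, Reach I N x a (m i)}

lemma IsFreePseudoplane.finite_hull (hT : IsFreePseudoplane M) {n : ℕ} {C : Set (Fin n → M)}
    (hC : C.Nonempty) (N : ℕ) : (hull C N).Finite := by
  obtain ⟨m, hm⟩ := hC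
  exact (FreePseudoplane.finite_hull hT.isAcyclic hT.infinite m N).subset fun a ha => ha m hm

/-- Quantifying over all tuples of `C`, rather than fixing one, keeps the parameters down to those
defining `C`. -/
lemma definable_hull {A : Set (Meq Language.graph M)} {n : ℕ} {C : Set (Fin n → M)}
    (ψ : ((Leq Language.graph M)[[A]]).Formula (Fin n))
    (hψ : ∀ zs : Fin n → Meq Language.graph M, ψ.Realize zs ↔ ∃ m ∈ C, zs = fun i => Meq.home (m i)) (N : ℕ) :
    A.Definable₁ (Leq Language.graph M) (Meq.home '' hull C N) := by
  let r : ((Leq Language.graph M)[[A]]).Relations 2 := Sum.inl (EqRel.ofRel Language.adj)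
  let s : ((Leq Language.graph M)[[A]]).Relations 1 := Sum.inl EqRel.homeSort
  -- Of the `n + 1` quantified variables, the first is the neighbour `x` and the others form the
  -- tuple `m`.
  refine ⟨s.formula₁ (Language.Term.var 0) ⊓ Language.Formula.iAlls (Fin (n + 1))
    (ψ.relabel (fun i => Sum.inr i.succ) ⟹
      (r.formula₂ (Language.Term.var (Sum.inr 0)) (Language.Term.var (Sum.inl 0)) ⟹
        Language.Formula.iSup fun i : Fin n =>
          (reachFormula r N).relabel ![Sum.inr 0, Sum.inl 0, Sum.inr i.succ])), ?_⟩
  have hr : ∀ x y : Meq Language.graph M, Language.Structure.RelMap r ![x, y] ↔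
      Language.Structure.RelMap (L := Leq Language.graph M) (EqRel.ofRel Language.adj) ![x, y] :=
    fun x y => Iff.rfl
  have hs : ∀ x : Meq Language.graph M, Language.Structure.RelMap s ![x] ↔ ∃ a, x = .home a :=
    fun x => Iff.rfl
  ext z
  simp only [Set.mem_ofPred_eq, Language.Formula.realize_inf, Language.Formula.realize_rel₁,
    Language.Formula.realize_iAlls, Language.Formula.realize_imp, Language.Formula.realize_relabel,
    Language.Formula.realize_rel₂, Language.Formula.realize_iSup, realize_reachFormula,
    Language.Term.realize_var, Sum.elim_inl, Sum.elim_inr, Function.comp_apply,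
    Matrix.cons_val_zero, Matrix.cons_val_one, Matrix.cons_val, hs, hr, hψ]
  constructor
  · rintro ⟨a, ha, haz⟩
    have hz : z 0 = .home a := haz.symm
    refine ⟨⟨a, hz⟩, ?_⟩
    rintro w ⟨m, hm, hw⟩ hadj
    obtain ⟨x, b, hx, hb, hxb⟩ := (relMap_ofRel_adj _ _).1 hadj
    obtain rfl : a = b := by
      rw [hz] at hb
      cases hb
      rfl
    obtain ⟨i, hi⟩ := ha m hm x hxb
    refine ⟨i, ?_⟩
    rw [hx, hz]
    exact (reach_home_iff _ _ _ _).2 ⟨m i, congrFun hw i, hi⟩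
  · rintro ⟨⟨a, hz⟩, h⟩
    refine ⟨a, fun m hm x hx => ?_, hz.symm⟩
    obtain ⟨i, hi⟩ := h (Fin.cons (.home x) fun i => .home (m i)) ⟨m, hm, by
      funext i
      simp⟩ ((relMap_ofRel_adj _ _).2 ⟨x, a, by simp, hz, hx⟩)
    rw [hz] at hi
    obtain ⟨y, hy, hr⟩ := (reach_home_iff _ _ _ _).1 hi
    refine ⟨i, ?_⟩
    have : (Meq.home (m i) : Meq Language.graph M) = .home y := by simpa using hy
    cases this
    exact hr

/-- By saturation, a vertex that no tuple of the definable set `C` avoids is in some `hull C N`. -/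
lemma IsFreePseudoplane.exists_mem_hull (hT : IsFreePseudoplane M)
    (hM : IsSaturated Language.graph M) {n : ℕ} {C : Set (Fin n → M)} {α : Type*} [Finite α]
    (v : α → M) (φ : Language.graph.Formula (α ⊕ Fin n))
    (hφ : ∀ m, m ∈ C ↔ φ.Realize (Sum.elim v m)) {a : M}
    (ha : ∀ m ∈ C, ∀ x, I x a → ∃ N i, Reach I N x a (m i)) : ∃ N, a ∈ hull C N := by
  by_contra hN
  have := hT.infinite_univ a
  let g : α ⊕ Fin n → (α ⊕ Fin 1) ⊕ Fin (n + 1) :=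
    Sum.elim (fun i => .inl (.inl i)) fun i => .inr i.succ
  -- `θ N` defines the pairs `(x, m)` witnessing that `a` is outside `hull C N`. These sets decrease
  -- with `N`, so a common witness exists if all are nonempty.
  let θ : ℕ → Language.graph.Formula ((α ⊕ Fin 1) ⊕ Fin (n + 1)) := fun N =>
    φ.relabel g ⊓ (Language.adj.formula₂ (Language.Term.var (.inr 0))
      (Language.Term.var (.inl (.inr 0))) ⊓ Language.Formula.iInf fun i : Fin n =>
        ∼((reachFormula Language.adj N).relabel ![.inr 0, .inl (.inr 0), .inr i.succ]))
  have hg : ∀ w : Fin (n + 1) → M,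
      Sum.elim (Sum.elim v fun _ => a) w ∘ g = Sum.elim v fun i => w i.succ := by
    intro w
    funext i
    rcases i with i | i <;> rfl
  have hθ : ∀ N (w : Fin (n + 1) → M), (θ N).Realize (Sum.elim (Sum.elim v fun _ => a) w) ↔
      (fun i => w i.succ) ∈ C ∧ I (w 0) a ∧ ∀ i : Fin n, ¬ Reach I N (w 0) a (w i.succ) := by
    intro N w
    simp only [θ, Language.Formula.realize_inf, Language.Formula.realize_relabel, hg, hφ,
      Language.Formula.realize_rel₂, Language.Formula.realize_iInf, Language.Formula.realize_not,
      realize_reachFormula, Language.Term.realize_var, Sum.elim_inl, Sum.elim_inr,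
      Function.comp_apply, Matrix.cons_val_zero, Matrix.cons_val_one, Matrix.cons_val]
    rfl
  obtain ⟨w, hw⟩ := hM.exists_forall_realize (Sum.elim v fun _ => a) θ (by
    intro i j hij w hw
    rw [hθ] at hw ⊢
    exact ⟨hw.1, hw.2.1, fun k hk => hw.2.2 k (hk.mono hij)⟩) (by
    intro N
    by_contra h
    refine hN ⟨N, fun m hm x hx => ?_⟩
    by_contra hi
    exact h ⟨Fin.cons x m, (hθ _ _).2 ⟨by simpa using hm, hx, by simpa using hi⟩⟩)
  simp only [hθ] at hw
  obtain ⟨N, i, hi⟩ := ha _ (hw 0).1 _ (hw 0).2.1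
  exact (hw N).2.2 i hi

/-- If the neighbourhood of `a` is weakly normal relative to `c`, and `C` is a set of tuples
definable in `M` with parameters and in `M^eq` over `c`, each of which has `c` in its definable
closure, then `a` is algebraic over `c`. -/
lemma IsFreePseudoplane.home_mem_acl (hT : IsFreePseudoplane M)
    (hM : IsSaturated Language.graph M) {a : M} {c : Meq Language.graph M}
    (hwn : WeaklyNormalRelTo (Leq Language.graph M) {c} (nbhd a))
    {n : ℕ} {C : Set (Fin n → M)} (hC : C.Nonempty) {α : Type*} [Finite α]
    (v : α → M) (φ : Language.graph.Formula (α ⊕ Fin n))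
    (hφ : ∀ m, m ∈ C ↔ φ.Realize (Sum.elim v m))
    (ψ : ((Leq Language.graph M)[[({c} : Set (Meq Language.graph M))]]).Formula (Fin n))
    (hψ : ∀ zs : Fin n → Meq Language.graph M, ψ.Realize zs ↔ ∃ m ∈ C, zs = fun i => Meq.home (m i))
    (hfix : ∀ m ∈ C, ∀ σ : M ≃[Language.graph] M, (∀ i, σ (m i) = m i) → Meq.map σ c = c) :
    Meq.home a ∈ acl (Leq Language.graph M) {c} := by
  obtain ⟨e, he⟩ := hT.exists_isChildEnum hM
  obtain ⟨N, hN⟩ := hT.exists_mem_hull hM v φ hφ (a := a) (by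
    intro m hm x hx
    -- Otherwise the branch at `x` through `a` avoids `m`, giving infinitely many conjugates over
    -- `m`; these are also conjugates over `c`.
    by_contra hcon
    refine hT.infinite_conjugates he hx (Set.finite_range m) ?_
      ((hwn.2 (.home x) ⟨x, hx, rfl⟩).subset ?_)
    · rintro _ ⟨i, rfl⟩ l hl
      obtain ⟨N, hN⟩ := exists_reach_branchEnd hT.isAcyclic he hx l
      exact hcon ⟨N, i, hl ▸ hN⟩
    · rintro Y ⟨hxY, σ, hσ, rfl⟩
      refine ⟨hxY, Meq.mapEquiv σ, ?_, rfl⟩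
      rintro _ rfl
      exact hfix m hm σ fun i => hσ _ ⟨i, rfl⟩)
  exact ⟨_, definable_hull ψ hψ N, (hT.finite_hull hC N).image _, ⟨a, hN, rfl⟩⟩

/-- The set `C` is the singleton of `c` for a home element, and the set of all representatives of
`c` for an imaginary. -/
lemma IsFreePseudoplane.home_mem_acl_of_weaklyNormalRelTo (hT : IsFreePseudoplane M)
    (hM : IsSaturated Language.graph M) {a : M} {c : Meq Language.graph M}
    (hwn : WeaklyNormalRelTo (Leq Language.graph M) {c} (nbhd a)) :
    Meq.home a ∈ acl (Leq Language.graph M) {c} := by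
  let k : ((Leq Language.graph M)[[({c} : Set (Meq Language.graph M))]]).Constants :=
    (Leq Language.graph M).con (⟨c, rfl⟩ : ({c} : Set (Meq Language.graph M)))
  have hk : (k : Meq Language.graph M) = c :=
    Language.coe_con (L := Leq Language.graph M) (A := ({c} : Set (Meq Language.graph M)))
  rcases c with b | ⟨S, q⟩
  · refine hT.home_mem_acl hM hwn (n := 1) (C := {m | m 0 = b}) ⟨fun _ => b, rfl⟩
      (fun _ : Fin 1 => b)
      ((Language.Term.var (.inr 0)).equal (Language.Term.var (.inl 0))) (fun m => by simp)
      ((Language.Term.var 0).equal k.term) (fun zs => ?_) ?_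
    · rw [Language.Formula.realize_equal, Language.Term.realize_constants, hk,
        Language.Term.realize_var]
      constructor
      · intro h
        exact ⟨fun _ => b, rfl, funext fun i => by rw [Subsingleton.elim i 0, h]⟩
      · rintro ⟨m, rfl, rfl⟩
        rfl
    · rintro m rfl σ hσ
      exact congrArg Meq.home (hσ 0)
  · induction q using Quotient.inductionOn with
    | h m₀ =>
      obtain ⟨φ, hφ⟩ := S.definable
      let r : ((Leq Language.graph M)[[({.cls S ⟦m₀⟧} :
        Set (Meq Language.graph M))]]).Relations (S.arity + 1) := Sum.inl (EqRel.proj S)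
      refine hT.home_mem_acl hM hwn (n := S.arity) (C := {m | S.rel m₀ m}) ⟨m₀, S.rel.refl m₀⟩
        m₀ φ (fun m => hφ m₀ m)
        (r.formula (Fin.snoc (α := fun _ => _) Language.Term.var k.term)) (fun zs => ?_) ?_
      · rw [Language.Formula.realize_rel]
        constructor
        · rintro ⟨v, hv, hS⟩
          simp only [Fin.snoc_last, Fin.snoc_castSucc, Language.Term.realize_constants, hk,
            Language.Term.realize_var] at hv hS
          refine ⟨v, ?_, funext hv⟩
          injection hS with _ h
          exact Quotient.exact h
        · rintro ⟨m, hm, rfl⟩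
          refine ⟨m, fun i => by simp, ?_⟩
          simp only [Fin.snoc_last, Language.Term.realize_constants, hk]
          exact congrArg _ (Quotient.sound hm)
      · intro m hm σ hσ
        have : (⟦m₀⟧ : Quotient S.rel) = ⟦m⟧ := Quotient.sound hm
        rw [this]
        exact congrArg (fun x => Meq.cls S ⟦x⟧) (funext hσ)

end Pseudoplane

end FreePseudoplane

theorem lemma3p4 {M : Type*} [FirstOrder.Language.graph.Structure M]
    (hT : FreePseudoplane.IsFreePseudoplane M)
    (hM : FreePseudoplane.IsSaturated FirstOrder.Language.graph M) (a : M) :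
    ¬ FreePseudoplane.WeaklyNormal (FreePseudoplane.Leq FirstOrder.Language.graph M)
        (FreePseudoplane.nbhd a) ∧
    ¬ ∃ c : FreePseudoplane.Meq FirstOrder.Language.graph M,
        FreePseudoplane.Meq.home a ∉
          FreePseudoplane.acl (FreePseudoplane.Leq FirstOrder.Language.graph M) {c} ∧
        FreePseudoplane.WeaklyNormalRelTo (FreePseudoplane.Leq FirstOrder.Language.graph M)
          {c} (FreePseudoplane.nbhd a) := by
  constructor
  · intro hwn
    obtain ⟨e, he⟩ := hT.exists_isChildEnum hM
    obtain ⟨x, hx⟩ := (hT.infinite a).nonempty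
    have hxa := hT.symm _ _ hx
    refine hT.infinite_conjugates he hxa Set.finite_empty (by simp)
      ((hwn.2 (.home x) ⟨x, hxa, rfl⟩).subset ?_)
    rintro Y ⟨hxY, σ, -, rfl⟩
    exact ⟨hxY, FreePseudoplane.Meq.mapEquiv σ, rfl⟩
  · rintro ⟨c, hc, hwn⟩
    exact hc (hT.home_mem_acl_of_weaklyNormalRelTo hM hwn)
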